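/- Let $m$ be a positive integer, $n=2m$, and let $k$ be a positive integer with $\gcd(k,m)=1$. For $l\in\{m,n\}$ let $\mathrm{Tr}_1^l:\mathbb{F}_{2^l}\to\mathbb{F}_2$, $\mathrm{Tr}_1^l(x)=\sum_{j=0}^{l-1}x^{2^j}$, be the absolute trace. A function $f:\mathbb{F}_{2^n}\to\mathbb{F}_2$ is called bent if $\left|\sum_{x\in\mathbb{F}_{2^n}}(-1)^{f(x)+\mathrm{Tr}_1^n(\beta x)}\right|=2^{n/2}$ for every $\beta\in\mathbb{F}_{2^n}$; it is called an idempotent if $f(x^2)=f(x)$ for all $x\in\mathbb{F}_{2^n}$, and a bent idempotent if it is both. Let $u$ be a normal element of $\mathbb{F}_{2^m}$, that is, $u,u^2,\dots,u^{2^{m-1}}$ is a basis of $\mathbb{F}_{2^m}$ over $\mathbb{F}_2$, and let $F\in\mathbb{F}_2[X_1,\dots,X_m]$ be a reduced polynomial (of degree at most $1$ in each variable). Then the function $f:\mathbb{F}_{2^n}\to\mathbb{F}_2$, $$f(x)=\mathrm{Tr}_1^m\left(x^{2^m+1}\right)+\mathrm{Tr}_1^n\left(\sum_{i=1}^{2^{k-1}-1}x^{(2^m-1)\frac{i}{2^k}+1}\right)+F\left(\mathrm{Tr}_1^n(ux),\mathrm{Tr}_1^n(u^2x),\dots,\mathrm{Tr}_1^n(u^{2^{m-1}}x)\right),$$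 where $i/2^k$ in the exponent denotes the integer in $\{0,\dots,2^m\}$ congruent to $i\cdot(2^k)^{-1}$ modulo $2^m+1$, is bent. If moreover $F$ is rotation symmetric, i.e. $F(X_m,X_1,\dots,X_{m-1})=F(X_1,\dots,X_m)$, then $f$ is a bent idempotent. -/

import Mathlib

noncomputable section

namespace NihoBent

/-- The subfield of a field `K` of characteristic 2 consisting of the roots of `X^(2^m) - X`.
When `K` has `2^(2m)` elements this is the subfield with `2^m` elements. -/
def midField (K : Type*) [Field K] [Algebra (ZMod 2) K] (m : ℕ) :
    IntermediateField (ZMod 2) K where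
  carrier := {x | x ^ 2 ^ m = x}
  mul_mem' := by
    intro a b ha hb
    simp only [Set.mem_ofPred_eq] at ha hb ⊢
    rw [mul_pow, ha, hb]
  add_mem' := by
    intro a b ha hb
    simp only [Set.mem_ofPred_eq] at ha hb ⊢
    have : CharP K 2 := charP_of_injective_algebraMap (algebraMap (ZMod 2) K).injective 2
    rw [add_pow_char_pow, ha, hb]
  algebraMap_mem' := by
    intro c
    simp only [Set.mem_ofPred_eq]
    rw [← map_pow, ZMod.pow_card_pow]
  inv_mem' := by
    intro a ha
    simp only [Set.mem_ofPred_eq] at ha ⊢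
    rw [inv_pow, ha]

section

variable {K : Type*} [Field K] [Fintype K] [Algebra (ZMod 2) K]

theorem pow_mem_midField {m : ℕ} (hK : Fintype.card K = 2 ^ (2 * m)) (x : K) :
    x ^ (2 ^ m + 1) ∈ midField K m := by
  change (x ^ (2 ^ m + 1)) ^ 2 ^ m = x ^ (2 ^ m + 1)
  have h : x ^ 2 ^ (2 * m) = x := by rw [← hK]; exact FiniteField.pow_card x
  rw [← pow_mul, add_mul, one_mul, ← pow_add, ← two_mul, pow_add, h, pow_succ, mul_comm]

/-- The Walsh transform `W_f(β) = ∑_x (-1)^(f(x) + Tr(βx))`, with `Tr` the absolute trace. -/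
def walsh (f : K → ZMod 2) (β : K) : ℤ :=
  ∑ x : K, (-1) ^ (f x + Algebra.trace (ZMod 2) K (β * x)).val

/-- `f` is bent: `|W_f(β)| = 2^(n/2)` for every `β`, where `n = [K : 𝔽₂]`. -/
def IsBent (f : K → ZMod 2) : Prop :=
  ∀ β : K, |(walsh f β : ℝ)| = (2 : ℝ) ^ ((Module.finrank (ZMod 2) K : ℝ) / 2)

/-- `f` is an idempotent: `f(x^2) = f(x)` for every `x`. -/
def IsIdempotentFun (f : K → ZMod 2) : Prop :=
  ∀ x : K, f (x ^ 2) = f x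

def IsBentIdempotent (f : K → ZMod 2) : Prop :=
  IsBent f ∧ IsIdempotentFun f

/-- The exponent `(2^m - 1) i / 2^k + 1`, where `i / 2^k` is computed modulo `2^m + 1`
(and represented in `{0, …, 2^m}`). -/
def nihoExponent (m k i : ℕ) : ℕ :=
  (2 ^ m - 1) * ((i : ZMod (2 ^ m + 1)) * ((2 : ZMod (2 ^ m + 1)) ^ k)⁻¹).val + 1

/-- The Leander–Kholosha function
`Tr_1^m(x^(2^m+1)) + Tr_1^n(∑_{i=1}^{2^(k-1)-1} x^((2^m-1) i/2^k + 1))`, `n = 2m`. -/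
def leanderKholosha (m k : ℕ) (hK : Fintype.card K = 2 ^ (2 * m)) (x : K) : ZMod 2 :=
  Algebra.trace (ZMod 2) (midField K m) ⟨x ^ (2 ^ m + 1), pow_mem_midField hK x⟩ +
    Algebra.trace (ZMod 2) K
      (∑ i ∈ Finset.Icc 1 (2 ^ (k - 1) - 1), x ^ nihoExponent m k i)

end

/-- `u` is a normal element of the degree `m` extension `L` of `𝔽₂`:
`u, u^2, …, u^(2^(m-1))` form a basis of `L` over `𝔽₂`. -/
def IsNormalElement {L : Type*} [Field L] [Algebra (ZMod 2) L] (m : ℕ) (u : L) : Prop :=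
  LinearIndependent (ZMod 2) (fun i : Fin m => u ^ 2 ^ (i : ℕ)) ∧
    Submodule.span (ZMod 2) (Set.range fun i : Fin m => u ^ 2 ^ (i : ℕ)) = ⊤

/-- A reduced polynomial: every variable occurs with exponent at most 1 in each monomial. -/
def IsReducedPoly {m : ℕ} (F : MvPolynomial (Fin m) (ZMod 2)) : Prop :=
  ∀ i : Fin m, F.degreeOf i ≤ 1

/-- `F(X_m, X_1, …, X_{m-1}) = F(X_1, …, X_m)`. -/
def IsRotationSymmetric {m : ℕ} (F : MvPolynomial (Fin m) (ZMod 2)) : Prop :=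
  MvPolynomial.rename (finRotate m).symm F = F

end NihoBent

end

/-! Let L be the middle field, T(x) = x + x^(2^m) the trace onto it, and g the Leander–Kholosha
part. With z = x^((2^m-1)/2^k) the Niho sum is geometric, and g collapses to Tr_1^m(x +
T(x)·(x/T(x))^(1/2^k)) (`powTrace_niho_eq`). Since T is constant on x + L and 2^k-th roots are
additive, g is affine there, with slope 1 + T(x)^(2^k-1) (`powTrace_niho_add`). The arguments of F
are also constant on x + L, because u ∈ L gives Tr_1^n(u^(2^i) y) = 0 for y ∈ L. As gcd(2^k-1,
2^m-1) = 1, the slope permutes L as T(x) runs over L. So for each β exactly one coset contributes to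
the Walsh sum, and it contributes ±2^m (`isBent_of_affine_on_cosets`). Idempotence: the trace is
Frobenius invariant, so squaring x rotates the arguments of F. -/

namespace NihoBent

/-! ### Traces as power sums inside `K` -/

section PowTrace

variable {K : Type*} [Field K]

/-- The polynomial expression `∑_{j<l} x^(2^j)` of the absolute trace of a field with `2^l`
elements, evaluated at an arbitrary element of `K`. -/
def powTrace (l : ℕ) (x : K) : K := ∑ j ∈ Finset.range l, x ^ 2 ^ j

variable [CharP K 2]

theorem powTrace_add (l : ℕ) (x y : K) : powTrace l (x + y) = powTrace l x + powTrace l y := by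
  simp only [powTrace, add_pow_char_pow, Finset.sum_add_distrib]

theorem powTrace_double (m : ℕ) (x : K) :
    powTrace (2 * m) x = powTrace m (x + x ^ 2 ^ m) := by
  rw [powTrace_add, powTrace, two_mul, Finset.sum_range_add]
  simp only [powTrace, pow_add, pow_mul]

theorem powTrace_sq (l : ℕ) (x : K) : powTrace l (x ^ 2) = powTrace l x + (x + x ^ 2 ^ l) := by
  have h : powTrace l (x ^ 2) = ∑ j ∈ Finset.range l, x ^ 2 ^ (j + 1) :=
    Finset.sum_congr rfl fun j _ => by rw [← pow_mul, pow_succ']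
  have h' := Finset.sum_range_succ' (fun j => x ^ 2 ^ j) l
  rw [Finset.sum_range_succ, ← h, pow_zero, pow_one] at h'
  change powTrace l x + _ = _ at h'
  linear_combination -h' + CharTwo.two_eq_zero (R := K) * (-x)

theorem powTrace_sq_of_pow_eq {l : ℕ} {x : K} (hx : x ^ 2 ^ l = x) :
    powTrace l (x ^ 2) = powTrace l x := by
  rw [powTrace_sq, hx, CharTwo.add_self_eq_zero, add_zero]

theorem powTrace_pow_two_pow_of_pow_eq {l : ℕ} {x : K} (hx : x ^ 2 ^ l = x) (k : ℕ) :
    powTrace l (x ^ 2 ^ k) = powTrace l x := by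
  induction k with
  | zero => simp
  | succ k ih =>
    rw [pow_succ, pow_mul, powTrace_sq_of_pow_eq, ih]
    rw [← pow_mul, mul_comm, pow_mul, hx]

end PowTrace

/-! ### The geometric sum behind the Niho exponents -/

section GeometricSum

variable {K : Type*} [Field K] [CharP K 2]

theorem add_one_mul_sum_Icc_pow (z : K) (h : ℕ) (hh : 0 < h) :
    (z + 1) * ∑ i ∈ Finset.Icc 1 (h - 1), z ^ i = z ^ h + z := by
  obtain ⟨n, rfl⟩ : ∃ n, h = n + 1 := ⟨h - 1, by omega⟩
  rw [Nat.add_sub_cancel]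
  induction n with
  | zero => simp [CharTwo.add_self_eq_zero]
  | succ n ih =>
    rw [Finset.sum_Icc_succ_top (by omega), mul_add, ih (by omega)]
    linear_combination CharTwo.two_eq_zero (R := K) * z ^ (n + 1)

/-- The trace to the middle field of the Niho sum at a point `x` with `x^(2^m) = x z^(2h)`. -/
theorem niho_sum_add_conj (m h : ℕ) (hh : 0 < h) (x z : K) (hz0 : z ≠ 0) (hz1 : z ≠ 1)
    (hz : z ^ 2 ^ m = z⁻¹) (hx : x ^ 2 ^ m = x * z ^ (2 * h)) :
    x * ∑ i ∈ Finset.Icc 1 (h - 1), z ^ i +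
      (x * ∑ i ∈ Finset.Icc 1 (h - 1), z ^ i) ^ 2 ^ m + x * z ^ h =
      x + (x + x ^ 2 ^ m) * (z + 1)⁻¹ := by
  have hz1' : z + 1 ≠ 0 := by rwa [Ne, CharTwo.add_eq_zero]
  have h1 := add_one_mul_sum_Icc_pow z h hh
  set P := ∑ i ∈ Finset.Icc 1 (h - 1), z ^ i
  -- Conjugate of `h1`: the 2^m-th power inverts `z`.
  have h2 : (z⁻¹ + 1) * P ^ 2 ^ m = (z ^ h)⁻¹ + z⁻¹ := by
    have := congrArg (· ^ 2 ^ m) h1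
    simp only [mul_pow, add_pow_char_pow, one_pow, hz] at this
    rw [this, ← pow_mul, mul_comm h, pow_mul, hz, inv_pow]
  have hM : z ^ h ≠ 0 := pow_ne_zero _ hz0
  rw [mul_pow, hx, mul_comm 2 h, pow_mul]
  set M := z ^ h
  have h3 : (z + 1) * (M * P ^ 2 ^ m) = z + M := by
    field_simp at h2
    linear_combination h2
  have h4 : (z + 1) * (x * P + x * M ^ 2 * P ^ 2 ^ m + x * M) =
      (z + 1) * (x + (x + x * M ^ 2) * (z + 1)⁻¹) := by
    have h5 : (z + 1) * (x + (x + x * M ^ 2) * (z + 1)⁻¹) = (z + 1) * x + (x + x * M ^ 2) := by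
      field_simp
    rw [h5]
    linear_combination x * h1 + x * M * h3 +
      CharTwo.two_eq_zero (R := K) * (x * M + x * M * z - x)
  exact mul_left_cancel₀ hz1' h4

end GeometricSum

/-! ### Closed form on `K` and affinity on cosets -/

section Exponent

variable {K : Type*} [Field K] {m : ℕ}

theorem pow_pow_add_one_eq_one (hq : ∀ x : K, x ^ 2 ^ (2 * m) = x) {x : K} (hx : x ≠ 0) :
    (x ^ (2 ^ m - 1)) ^ (2 ^ m + 1) = 1 := by
  have h1 : (2 ^ m - 1) * (2 ^ m + 1) + 1 = 2 ^ (2 * m) := by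
    obtain ⟨a, ha⟩ : ∃ a, 2 ^ m = a + 1 := ⟨2 ^ m - 1, by have := Nat.one_le_two_pow (n := m); omega⟩
    rw [mul_comm 2 m, pow_mul, ha, Nat.add_sub_cancel]
    ring
  have h2 := hq x
  rw [← h1, pow_succ, pow_mul] at h2
  exact mul_right_cancel₀ hx (by rw [h2, one_mul])

/-- `x^((2^m - 1)/2^k)`, with `1/2^k` computed modulo `2^m + 1`. -/
def nihoRoot (m k : ℕ) (x : K) : K :=
  (x ^ (2 ^ m - 1)) ^ ((2 : ZMod (2 ^ m + 1)) ^ k)⁻¹.val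

theorem pow_nihoExponent (hq : ∀ x : K, x ^ 2 ^ (2 * m) = x) {x : K} (hx : x ≠ 0) (k i : ℕ) :
    x ^ nihoExponent m k i = x * nihoRoot m k x ^ i := by
  rw [nihoExponent, pow_succ, pow_mul, mul_comm, nihoRoot, ← pow_mul _ _ i]
  congr 1
  refine pow_eq_pow_of_modEq ((ZMod.natCast_eq_natCast_iff _ _ _).1 ?_)
    (pow_pow_add_one_eq_one hq hx)
  rw [Nat.cast_mul, ZMod.natCast_zmod_val, ZMod.natCast_zmod_val, mul_comm]

theorem nihoRoot_pow (hm : 0 < m) (hq : ∀ x : K, x ^ 2 ^ (2 * m) = x) {x : K} (hx : x ≠ 0)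
    (k : ℕ) : nihoRoot m k x ^ 2 ^ k = x ^ (2 ^ m - 1) := by
  rw [nihoRoot, ← pow_mul]
  conv_rhs => rw [← pow_one (x ^ (2 ^ m - 1))]
  refine pow_eq_pow_of_modEq ((ZMod.natCast_eq_natCast_iff _ _ _).1 ?_)
    (pow_pow_add_one_eq_one hq hx)
  -- As m > 0, the modulus 2^m + 1 is odd, so the inverse in `ZMod` is a genuine one.
  have h : Nat.Coprime (2 ^ k) (2 ^ m + 1) := by
    refine Nat.Coprime.pow_left _ (Nat.coprime_two_left.2 ?_)
    exact (Even.pow_of_ne_zero even_two hm.ne').add_one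
  have := ZMod.coe_mul_inv_eq_one _ h
  push_cast at this ⊢
  rw [ZMod.natCast_zmod_val, mul_comm, this]

theorem nihoRoot_ne_zero {x : K} (hx : x ≠ 0) (k : ℕ) : nihoRoot m k x ≠ 0 :=
  pow_ne_zero _ (pow_ne_zero _ hx)

theorem nihoRoot_pow_two_pow (hq : ∀ x : K, x ^ 2 ^ (2 * m) = x) {x : K} (hx : x ≠ 0) (k : ℕ) :
    nihoRoot m k x ^ 2 ^ m = (nihoRoot m k x)⁻¹ := by
  refine eq_inv_of_mul_eq_one_left ?_
  rw [← pow_succ, nihoRoot, pow_right_comm, pow_pow_add_one_eq_one hq hx, one_pow]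

variable [CharP K 2] [PerfectRing K 2]

/-- Both traces are brought to Tr_1^m, where x^(2^m+1) = (x z^h)^2 may be replaced by x z^h. The sum
then closes up with 1/(z+1), and T(x) = x(z+1)^(2^k) identifies this as the 2^k-th root of x/T(x).
-/
theorem powTrace_niho_eq (hm : 0 < m) {k : ℕ} (hk : 0 < k) (hq : ∀ x : K, x ^ 2 ^ (2 * m) = x)
    (x : K) :
    powTrace m (x ^ (2 ^ m + 1)) +
      powTrace (2 * m) (∑ i ∈ Finset.Icc 1 (2 ^ (k - 1) - 1), x ^ nihoExponent m k i) =
    powTrace m (x + (x + x ^ 2 ^ m) *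
      (iterateFrobeniusEquiv K 2 k).symm (x / (x + x ^ 2 ^ m))) := by
  rcases eq_or_ne x 0 with rfl | hx
  · simp [powTrace, nihoExponent]
  have hz0 := nihoRoot_ne_zero (m := m) hx k
  have hzq := nihoRoot_pow_two_pow hq hx k
  have hzk := nihoRoot_pow hm hq hx k
  simp only [pow_nihoExponent hq hx, ← Finset.mul_sum]
  set z := nihoRoot m k x
  have hk2 : 2 * 2 ^ (k - 1) = 2 ^ k := by rw [← pow_succ', Nat.sub_add_cancel hk]
  have hh : 0 < 2 ^ (k - 1) := by positivity
  set h := 2 ^ (k - 1)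
  have hxz : x ^ 2 ^ m = x * z ^ (2 * h) := by
    rw [hk2, hzk, ← pow_succ', Nat.sub_add_cancel Nat.one_le_two_pow]
  have hfix : (x * z ^ h) ^ 2 ^ m = x * z ^ h := by
    rw [mul_pow, pow_right_comm, hzq, hxz, two_mul, pow_add, inv_pow]
    field_simp
  have hT : powTrace m (x ^ (2 ^ m + 1)) = powTrace m (x * z ^ h) := by
    rw [← powTrace_sq_of_pow_eq hfix, pow_succ, hxz]
    ring_nf
  rw [hT, powTrace_double, ← powTrace_add]
  congr 1
  -- If z = 1 then T(x) = 0: the Niho terms cancel in pairs, and x/0 = 0 causes no harm.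
  rcases eq_or_ne z 1 with h1 | h1
  · have hxq : x ^ 2 ^ m = x := by rw [hxz, h1, one_pow, mul_one]
    have hN : ∀ N : ℕ, (N : K) ^ 2 ^ m = N := fun N => by
      rw [← iterateFrobenius_def, map_natCast]
    simp only [h1, one_pow, Finset.sum_const, nsmul_eq_mul, mul_one, mul_pow, hxq, hN,
      CharTwo.add_self_eq_zero, zero_mul]
  · rw [add_comm, niho_sum_add_conj m h hh x z hz0 h1 hzq hxz]
    congr 2
    rw [eq_comm, RingEquiv.symm_apply_eq, iterateFrobeniusEquiv_def, inv_pow, add_pow_char_pow,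
      one_pow, hxz, hk2]
    have h2 : z ^ 2 ^ k + 1 ≠ 0 := by
      rw [← one_pow (2 ^ k), ← add_pow_char_pow]
      exact pow_ne_zero _ (by rwa [Ne, CharTwo.add_eq_zero])
    have h3 : x + x * z ^ 2 ^ k = x * (z ^ 2 ^ k + 1) := by ring
    rw [h3]
    field_simp

/-- The Leander–Kholosha function is affine on the cosets of the middle field. -/
theorem powTrace_niho_add (hm : 0 < m) {k : ℕ} (hk : 0 < k) (hq : ∀ x : K, x ^ 2 ^ (2 * m) = x)
    (x y : K) (hy : y ^ 2 ^ m = y) :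
    powTrace m ((x + y) ^ (2 ^ m + 1)) +
      powTrace (2 * m) (∑ i ∈ Finset.Icc 1 (2 ^ (k - 1) - 1), (x + y) ^ nihoExponent m k i) =
    powTrace m (x ^ (2 ^ m + 1)) +
      powTrace (2 * m) (∑ i ∈ Finset.Icc 1 (2 ^ (k - 1) - 1), x ^ nihoExponent m k i) +
    powTrace m ((1 + (x + x ^ 2 ^ m) ^ (2 ^ k - 1)) * y) := by
  have hs : (x + y) + (x + y) ^ 2 ^ m = x + x ^ 2 ^ m := by
    rw [add_pow_char_pow, hy]
    linear_combination CharTwo.two_eq_zero (R := K) * y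
  have hsq : (x + x ^ 2 ^ m) ^ 2 ^ m = x + x ^ 2 ^ m := by
    rw [add_pow_char_pow, ← pow_mul, ← pow_add, ← two_mul, hq, add_comm]
  rw [powTrace_niho_eq hm hk hq, powTrace_niho_eq hm hk hq, hs, add_div, map_add]
  set s := x + x ^ 2 ^ m
  set ρ := (iterateFrobeniusEquiv K 2 k).symm
  have hρ : ∀ w, ρ w ^ 2 ^ k = w := fun w => by
    rw [← iterateFrobeniusEquiv_def, RingEquiv.apply_symm_apply]
  have hw : (s * ρ (y / s)) ^ 2 ^ m = s * ρ (y / s) := by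
    rw [mul_pow, hsq, ← map_pow, div_pow, hy, hsq]
  -- A 2^k-th power preserves the trace and turns s·(y/s)^(1/2^k) into s^(2^k)·y/s.
  have h1 : powTrace m (s * ρ (y / s)) = powTrace m (s ^ (2 ^ k - 1) * y) := by
    rw [← powTrace_pow_two_pow_of_pow_eq hw k, mul_pow, hρ]
    congr 1
    rcases eq_or_ne s 0 with h0 | h0
    · have : 2 ^ k - 1 ≠ 0 := by
        have := Nat.one_lt_two_pow hk.ne'
        omega
      simp [h0, this]
    · rw [← Nat.sub_add_cancel (Nat.one_le_two_pow (n := k)), pow_succ, Nat.add_sub_cancel]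
      field_simp
  rw [add_mul 1, one_mul, mul_add s]
  simp only [powTrace_add, h1]
  ring

end Exponent

end NihoBent

namespace NihoBent

/-! ### Character sums and power permutations -/

section Sign

theorem neg_one_pow_val_add (a b : ZMod 2) :
    (-1 : ℤ) ^ (a + b).val = (-1) ^ a.val * (-1) ^ b.val := by
  revert a b; decide

/-- Translating y by c⁻¹z with Tr(z) = 1 flips the sign of every term. -/
theorem sum_neg_one_pow_trace_mul {L : Type*} [Field L] [Fintype L] [Algebra (ZMod 2) L] {c : L}
    (hc : c ≠ 0) : ∑ y : L, (-1 : ℤ) ^ (Algebra.trace (ZMod 2) L (c * y)).val = 0 := by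
  obtain ⟨z, hz⟩ := Algebra.trace_surjective (ZMod 2) L 1
  have h := Fintype.sum_equiv (Equiv.addRight (c⁻¹ * z))
    (fun y => (-1 : ℤ) ^ (Algebra.trace (ZMod 2) L (c * (y + c⁻¹ * z))).val)
    (fun y => (-1 : ℤ) ^ (Algebra.trace (ZMod 2) L (c * y)).val) (fun _ => rfl)
  simp only [mul_add, mul_inv_cancel_left₀ hc, map_add, hz, neg_one_pow_val_add,
    ← Finset.sum_mul] at h
  rw [show ((1 : ZMod 2).val) = 1 from rfl] at h
  linarith

end Sign

theorem pow_left_injective_of_coprime_card {L : Type*} [Field L] [Fintype L] {N : ℕ} (hN : 0 < N)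
    (h : Nat.Coprime N (Fintype.card L - 1)) : Function.Injective fun s : L => s ^ N := by
  intro a b hab
  simp only at hab
  rcases eq_or_ne b 0 with rfl | hb
  · rw [zero_pow hN.ne'] at hab
    exact pow_eq_zero_iff hN.ne' |>.1 hab
  have ha : a ≠ 0 := by
    rintro rfl
    rw [zero_pow hN.ne'] at hab
    exact pow_ne_zero N hb hab.symm
  have h1 : (a / b) ^ N = 1 := by rw [div_pow, hab, div_self (pow_ne_zero _ hb)]
  have h2 : (a / b) ^ (Fintype.card L - 1) = 1 :=
    FiniteField.pow_card_sub_one_eq_one _ (div_ne_zero ha hb)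
  have h3 : (a / b) ^ (Nat.gcd N (Fintype.card L - 1)) = 1 :=
    pow_gcd_eq_one.2 ⟨h1, h2⟩
  rw [h, pow_one] at h3
  exact (div_eq_one_iff_eq hb).1 h3

theorem coprime_two_pow_sub_one {k m : ℕ} (h : Nat.Coprime k m) :
    Nat.Coprime (2 ^ k - 1) (2 ^ m - 1) := by
  rw [Nat.Coprime, Nat.pow_sub_one_gcd_pow_sub_one, h]
  rfl

theorem pow_two_pow_two_mul {K : Type*} [Field K] [Fintype K] {m : ℕ}
    (hK : Fintype.card K = 2 ^ (2 * m)) (x : K) :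
    x ^ 2 ^ (2 * m) = x := by
  rw [← hK, FiniteField.pow_card]

/-! ### The relative trace to the middle field -/

section Trace

variable {K : Type*} [Field K] [Fintype K] [Algebra (ZMod 2) K] {m : ℕ}

theorem finrank_of_card (hK : Fintype.card K = 2 ^ (2 * m)) :
    Module.finrank (ZMod 2) K = 2 * m := by
  have h := Module.card_eq_pow_finrank (K := ZMod 2) (V := K)
  rw [hK, ZMod.card] at h
  exact (Nat.pow_right_injective le_rfl h).symm

theorem IsNormalElement.finrank_eq {L : Type*} [Field L] [Algebra (ZMod 2) L] {u : L}
    (hu : IsNormalElement m u) : Module.finrank (ZMod 2) L = m := by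
  simpa using Module.finrank_eq_card_basis (Module.Basis.mk hu.1 hu.2.ge)

theorem algebraMap_trace_eq_powTrace {l : ℕ} (h : Module.finrank (ZMod 2) K = l) (x : K) :
    algebraMap (ZMod 2) K (Algebra.trace (ZMod 2) K x) = powTrace l x := by
  rw [FiniteField.algebraMap_trace_eq_sum_pow, h, Nat.card_zmod, powTrace]

theorem algebraMap_trace_midField (h : Module.finrank (ZMod 2) (midField K m) = m)
    (y : midField K m) :
    algebraMap (ZMod 2) K (Algebra.trace (ZMod 2) (midField K m) y) = powTrace m (y : K) := by
  rw [IsScalarTower.algebraMap_apply (ZMod 2) (midField K m) K,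
    FiniteField.algebraMap_trace_eq_sum_pow, h, Nat.card_zmod, powTrace, map_sum]
  rfl

theorem algebraMap_leanderKholosha (hK : Fintype.card K = 2 ^ (2 * m))
    (h : Module.finrank (ZMod 2) (midField K m) = m) (k : ℕ) (x : K) :
    algebraMap (ZMod 2) K (leanderKholosha m k hK x) =
      powTrace m (x ^ (2 ^ m + 1)) +
        powTrace (2 * m) (∑ i ∈ Finset.Icc 1 (2 ^ (k - 1) - 1), x ^ nihoExponent m k i) := by
  rw [leanderKholosha, map_add, algebraMap_trace_midField h,
    algebraMap_trace_eq_powTrace (finrank_of_card hK)]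

theorem add_conj_mem_midField (hK : Fintype.card K = 2 ^ (2 * m)) (x : K) :
    x + x ^ 2 ^ m ∈ midField K m := by
  have : CharP K 2 := charP_of_injective_algebraMap (algebraMap (ZMod 2) K).injective 2
  change (x + x ^ 2 ^ m) ^ 2 ^ m = _
  rw [add_pow_char_pow, ← pow_mul, ← pow_add, ← two_mul, pow_two_pow_two_mul hK, add_comm]

/-- The trace from `K` to its middle field, `x ↦ x + x^(2^m)`. -/
def midTrace (hK : Fintype.card K = 2 ^ (2 * m)) (x : K) : midField K m :=
  ⟨x + x ^ 2 ^ m, add_conj_mem_midField hK x⟩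

theorem midTrace_add (hK : Fintype.card K = 2 ^ (2 * m)) (x y : K) :
    midTrace hK (x + y) = midTrace hK x + midTrace hK y := by
  have : CharP K 2 := charP_of_injective_algebraMap (algebraMap (ZMod 2) K).injective 2
  refine Subtype.ext ?_
  change (x + y) + (x + y) ^ 2 ^ m = (x + x ^ 2 ^ m) + (y + y ^ 2 ^ m)
  rw [add_pow_char_pow]
  ring

theorem midTrace_eq_zero_iff (hK : Fintype.card K = 2 ^ (2 * m)) (x : K) :
    midTrace hK x = 0 ↔ x ∈ midField K m := by
  have : CharP K 2 := charP_of_injective_algebraMap (algebraMap (ZMod 2) K).injective 2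
  rw [← Subtype.coe_inj]
  change x + x ^ 2 ^ m = 0 ↔ x ^ 2 ^ m = x
  rw [CharTwo.add_eq_zero, eq_comm]

theorem trace_mul_coe_midField (hK : Fintype.card K = 2 ^ (2 * m))
    (h : Module.finrank (ZMod 2) (midField K m) = m) (b : K) (y : midField K m) :
    Algebra.trace (ZMod 2) K (b * y) =
      Algebra.trace (ZMod 2) (midField K m) (midTrace hK b * y) := by
  have : CharP K 2 := charP_of_injective_algebraMap (algebraMap (ZMod 2) K).injective 2
  apply (algebraMap (ZMod 2) K).injective
  rw [algebraMap_trace_midField h, algebraMap_trace_eq_powTrace (finrank_of_card hK),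
    powTrace_double, mul_pow]
  have hy : (y : K) ^ 2 ^ m = y := y.2
  rw [hy, ← add_mul]
  rfl

theorem leanderKholosha_add (hm : 0 < m) {k : ℕ} (hk : 0 < k)
    (hK : Fintype.card K = 2 ^ (2 * m))
    (h : Module.finrank (ZMod 2) (midField K m) = m) (x : K) (y : midField K m) :
    leanderKholosha m k hK (x + y) = leanderKholosha m k hK x +
      Algebra.trace (ZMod 2) (midField K m) ((1 + midTrace hK x ^ (2 ^ k - 1)) * y) := by
  have : CharP K 2 := charP_of_injective_algebraMap (algebraMap (ZMod 2) K).injective 2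
  apply (algebraMap (ZMod 2) K).injective
  rw [map_add, algebraMap_trace_midField h, algebraMap_leanderKholosha hK h,
    algebraMap_leanderKholosha hK h,
    powTrace_niho_add hm hk (pow_two_pow_two_mul hK) x y y.2]
  rfl

/-- Counting: the kernel is L, so the image has 2^(2m)/2^m = |L| elements. -/
theorem midTrace_surjective (hK : Fintype.card K = 2 ^ (2 * m))
    (h : Module.finrank (ZMod 2) (midField K m) = m) :
    Function.Surjective (midTrace hK) := by
  let φ : K →+ midField K m := AddMonoidHom.mk' (midTrace hK) (midTrace_add hK)
  have hL : Nat.card (midField K m) = 2 ^ m := by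
    rw [Module.natCard_eq_pow_finrank (K := ZMod 2), h, Nat.card_zmod]
  have hker : Nat.card φ.ker = 2 ^ m := by
    rw [← hL]
    exact Nat.card_congr (Equiv.subtypeEquivRight fun x => midTrace_eq_zero_iff hK x)
  have h1 := AddSubgroup.card_eq_card_quotient_mul_card_addSubgroup φ.ker
  rw [Nat.card_congr (QuotientAddGroup.quotientKerEquivRange φ).toEquiv, hker,
    Nat.card_eq_fintype_card, hK, two_mul, pow_add] at h1
  have h2 := Nat.eq_of_mul_eq_mul_right (by positivity) h1
  exact AddMonoidHom.range_eq_top.1 (AddSubgroup.eq_top_of_card_eq _ (by rw [← h2, hL]))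

end Trace

/-! ### Walsh transform of functions affine on cosets -/

section Bent

variable {K : Type*} [Field K] [Fintype K] [Algebra (ZMod 2) K] {m : ℕ}

/-- A Maiorana–McFarland type criterion: a function which on every coset of the middle field is
affine, with linear part given by a permutation of the middle field, is bent. -/
theorem isBent_of_affine_on_cosets (hK : Fintype.card K = 2 ^ (2 * m))
    (h : Module.finrank (ZMod 2) (midField K m) = m) (f : K → ZMod 2)
    (p : midField K m → midField K m) (hp : Function.Bijective p)
    (hf : ∀ (x : K) (y : midField K m), f (x + y) = f x +
      Algebra.trace (ZMod 2) (midField K m) (p (midTrace hK x) * y)) : IsBent f := by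
  classical
  have hchar : CharP (midField K m) 2 :=
    charP_of_injective_algebraMap (algebraMap (ZMod 2) (midField K m)).injective 2
  have hL : Fintype.card (midField K m) = 2 ^ m := by
    rw [← Nat.card_eq_fintype_card, Module.natCard_eq_pow_finrank (K := ZMod 2), h, Nat.card_zmod]
  intro β
  set χ : K → ℤ := fun x => (-1) ^ (f x + Algebra.trace (ZMod 2) K (β * x)).val
  have hχ : ∀ (x : K) (y : midField K m), χ (x + y) = χ x *
      (-1) ^ (Algebra.trace (ZMod 2) (midField K m)
        ((p (midTrace hK x) + midTrace hK β) * y)).val := by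
    intro x y
    simp only [χ]
    rw [← neg_one_pow_val_add, hf, mul_add, map_add, trace_mul_coe_midField hK h, add_mul, map_add]
    congr 2
    ring
  obtain ⟨s, hs⟩ := hp.2 (midTrace hK β)
  obtain ⟨x₀, hx₀⟩ := midTrace_surjective hK h s
  have hcoset : ∀ x, midTrace hK x = s ↔ ∃ y : midField K m, x₀ + y = x := by
    intro x
    constructor
    · intro hx
      refine ⟨⟨x - x₀, (midTrace_eq_zero_iff hK _).1 ?_⟩, by simp⟩
      have := midTrace_add hK (x - x₀) x₀
      rwa [sub_add_cancel, hx, hx₀, right_eq_add] at this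
    · rintro ⟨y, rfl⟩
      rw [midTrace_add, (midTrace_eq_zero_iff hK (y : K)).2 y.2, hx₀, add_zero]
  -- Summing over all translates by L counts the Walsh sum 2^m times and avoids choosing coset
  -- representatives.
  have h1 : (2 : ℤ) ^ m * walsh f β = ∑ x : K, ∑ y : midField K m, χ (x + y) := by
    rw [Finset.sum_comm]
    have : ∀ y : midField K m, ∑ x : K, χ (x + y) = walsh f β := fun y =>
      Fintype.sum_equiv (Equiv.addRight (y : K)) _ _ fun _ => rfl
    simp [this, hL]
  have h2 : ∀ x : K, ∑ y : midField K m, χ (x + y) =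
      if midTrace hK x = s then 2 ^ m * χ x₀ else 0 := by
    intro x
    split_ifs with hx
    · have : ∀ y : midField K m, χ (x + y) = χ x := by
        intro y
        rw [hχ, hx, hs, CharTwo.add_self_eq_zero, zero_mul, map_zero, ZMod.val_zero, pow_zero,
          mul_one]
      obtain ⟨y, rfl⟩ := (hcoset x).1 hx
      have hxy : χ (x₀ + y) = χ x₀ := by
        rw [hχ, hx₀, hs, CharTwo.add_self_eq_zero, zero_mul, map_zero, ZMod.val_zero, pow_zero,
          mul_one]
      simp [this, hL, hxy]
    · simp only [hχ, ← Finset.mul_sum]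
      rw [sum_neg_one_pow_trace_mul, mul_zero]
      rw [Ne, CharTwo.add_eq_zero, ← hs]
      exact fun h' => hx (hp.1 h')
  have h3 : (Finset.univ.filter fun x : K => midTrace hK x = s).card = 2 ^ m := by
    rw [← hL, ← Finset.card_univ]
    symm
    refine Finset.card_bij (fun y _ => x₀ + (y : K)) ?_ ?_ ?_
    · intro y _
      simpa using (hcoset _).2 ⟨y, rfl⟩
    · intro a _ b _ hab
      exact Subtype.ext (add_left_cancel hab)
    · intro x hx
      obtain ⟨y, hy⟩ := (hcoset x).1 (by simpa using hx)
      exact ⟨y, Finset.mem_univ _, hy⟩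
  have h4 : walsh f β = 2 ^ m * χ x₀ := by
    simp only [h2, ← Finset.sum_filter, Finset.sum_const, h3, nsmul_eq_mul] at h1
    push_cast at h1
    exact mul_left_cancel₀ (by positivity) h1
  have h5 : |χ x₀| = 1 := by simp [χ, abs_pow]
  have h6 : |walsh f β| = 2 ^ m := by
    rw [h4, abs_mul, h5, mul_one, abs_of_pos (by positivity)]
  rw [finrank_of_card hK, ← Int.cast_abs, h6]
  push_cast
  rw [mul_div_cancel_left₀ _ two_ne_zero, Real.rpow_natCast]

end Bent

/-! ### Invariance under squaring -/

section Idempotent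

variable {K : Type*} [Field K] [Fintype K] [Algebra (ZMod 2) K] {m : ℕ}

theorem trace_sq {L : Type*} [Field L] [Finite L] [Algebra (ZMod 2) L] (x : L) :
    Algebra.trace (ZMod 2) L (x ^ 2) = Algebra.trace (ZMod 2) L x := by
  simpa using Algebra.trace_eq_of_algEquiv (FiniteField.frobeniusAlgEquivOfAlgebraic (ZMod 2) L) x

theorem leanderKholosha_sq (hK : Fintype.card K = 2 ^ (2 * m)) (k : ℕ) (x : K) :
    leanderKholosha m k hK (x ^ 2) = leanderKholosha m k hK x := by
  have : CharP K 2 := charP_of_injective_algebraMap (algebraMap (ZMod 2) K).injective 2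
  rw [leanderKholosha, leanderKholosha]
  congr 1
  · rw [← trace_sq (⟨x ^ (2 ^ m + 1), pow_mem_midField hK x⟩ : midField K m)]
    congr 1
    exact Subtype.ext (pow_right_comm _ _ _)
  · rw [← trace_sq (∑ i ∈ _, x ^ _), CharTwo.sum_sq]
    simp only [pow_right_comm x 2]

theorem trace_normal_mul_sq (u : midField K m) (x : K) (i : Fin m) :
    Algebra.trace (ZMod 2) K ((u : K) ^ 2 ^ (i : ℕ) * x ^ 2) =
      Algebra.trace (ZMod 2) K ((u : K) ^ 2 ^ (((finRotate m).symm i : Fin m) : ℕ) * x) := by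
  obtain ⟨j, rfl⟩ := (finRotate m).surjective i
  rw [Equiv.symm_apply_apply, ← trace_sq (_ * x), mul_pow, ← pow_mul, ← pow_succ]
  congr 2
  obtain ⟨n, rfl⟩ : ∃ n, m = n + 1 := ⟨m - 1, by have := j.2; omega⟩
  have hu : (u : K) ^ 2 ^ (n + 1) = u := u.2
  rw [coe_finRotate]
  -- The wrap-around of the rotation is u^(2^m) = u.
  split_ifs with hj
  · rw [hj, Fin.val_last, hu, pow_zero, pow_one]
  · rfl

end Idempotent

section LeanderKholosha

variable {K : Type*} [Field K] [Fintype K] [Algebra (ZMod 2) K] {m k : ℕ}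

theorem isBent_leanderKholosha_add_eval (hm : 0 < m) (hk : 0 < k) (hkm : Nat.Coprime k m)
    (hK : Fintype.card K = 2 ^ (2 * m)) (h : Module.finrank (ZMod 2) (midField K m) = m)
    (u : midField K m) (F : MvPolynomial (Fin m) (ZMod 2)) :
    IsBent fun x : K => leanderKholosha m k hK x + MvPolynomial.eval
      (fun i : Fin m => Algebra.trace (ZMod 2) K ((u : K) ^ 2 ^ (i : ℕ) * x)) F := by
  classical
  have hL : Fintype.card (midField K m) = 2 ^ m := by
    rw [← Nat.card_eq_fintype_card, Module.natCard_eq_pow_finrank (K := ZMod 2), h, Nat.card_zmod]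
  have hinj : Function.Injective fun s : midField K m => s ^ (2 ^ k - 1) := by
    refine pow_left_injective_of_coprime_card ?_ (by rw [hL]; exact coprime_two_pow_sub_one hkm)
    have := Nat.one_lt_two_pow hk.ne'
    omega
  refine isBent_of_affine_on_cosets hK h _ (fun s => 1 + s ^ (2 ^ k - 1))
    (Finite.injective_iff_bijective.1 ((add_right_injective 1).comp hinj)) fun x y => ?_
  have hu0 : ∀ i : Fin m, Algebra.trace (ZMod 2) K ((u : K) ^ 2 ^ (i : ℕ) * y) = 0 := by
    intro i
    rw [trace_mul_coe_midField hK h, (midTrace_eq_zero_iff hK _).2 (pow_mem u.2 _), zero_mul,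
      map_zero]
  simp only [leanderKholosha_add hm hk hK h, mul_add, map_add, hu0, add_zero]
  ring

theorem isIdempotentFun_leanderKholosha_add_eval (hK : Fintype.card K = 2 ^ (2 * m))
    (u : midField K m) (F : MvPolynomial (Fin m) (ZMod 2)) (hF : IsRotationSymmetric F) :
    IsIdempotentFun fun x : K => leanderKholosha m k hK x + MvPolynomial.eval
      (fun i : Fin m => Algebra.trace (ZMod 2) K ((u : K) ^ 2 ^ (i : ℕ) * x)) F := by
  intro x
  simp only [trace_normal_mul_sq, leanderKholosha_sq]
  conv_rhs => rw [← show _ = F from hF, MvPolynomial.eval_rename]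
  rfl

end LeanderKholosha

end NihoBent

theorem corollary3p7 {K : Type*} [Field K] [Fintype K] [Algebra (ZMod 2) K]
    (m k : ℕ) (hm : 0 < m) (hk : 0 < k) (hkm : Nat.Coprime k m)
    (hK : Fintype.card K = 2 ^ (2 * m))
    (u : NihoBent.midField K m) (hu : NihoBent.IsNormalElement m u)
    (F : MvPolynomial (Fin m) (ZMod 2)) (hF : NihoBent.IsReducedPoly F)
    (f : K → ZMod 2)
    (hf : ∀ x : K, f x = NihoBent.leanderKholosha m k hK x +
      MvPolynomial.eval
        (fun i : Fin m => Algebra.trace (ZMod 2) K ((u : K) ^ 2 ^ (i : ℕ) * x)) F) :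
    NihoBent.IsBent f ∧
      (NihoBent.IsRotationSymmetric F → NihoBent.IsBentIdempotent f) := by
  obtain rfl := funext hf
  -- Normality of `u` supplies [L : 𝔽₂] = m.
  have hbent := NihoBent.isBent_leanderKholosha_add_eval hm hk hkm hK hu.finrank_eq u F
  exact ⟨hbent, fun hrot =>
    ⟨hbent, NihoBent.isIdempotentFun_leanderKholosha_add_eval hK u F hrot⟩⟩
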